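/- Let $G$ be a finite simple connected graph with vertex set $\mathcal V$, $|\mathcal V| = n$, in which every vertex has degree at least two; write $G_i$ for the set of neighbours of a vertex $i$. A $k$-let of $G$ is a set of $k$ distinct vertices that all have the same set of neighbours. In $\mathbb{C}[x_i, y_i : i \in \mathcal V]$ let \[ f_i = \sum_{j \in G_i} (x_j y_i - x_i y_j), \qquad I_K = \langle f_i,\; x_i^2 + y_i^2 - 1 \;:\; i \in \mathcal V \rangle , \] and let $\mathbb{V}(I_K) \subset \mathbb{C}^{2n}$ be the Kuramoto variety. For a vertex $v_0$ let $X_{v_0} = \mathbb{V}(I_K + \langle x_{v_0},\, y_{v_0} - 1 \rangle)$ be the Kuramoto variety normalized by $\theta_{v_0} = 0$, which removes the rotational symmetry. Angles $\theta \in \mathbb{R}^{\mathcal V}$ are encoded, after a rotation, by the point $p_{v_0}(\theta)$ with coordinates $x_i = \sin(\theta_i - \theta_{v_0})$, $y_i = \cos(\theta_i - \theta_{v_0})$. An equilibrium $\theta$ of the homogeneous Kuramoto system $\dot\theta_i = \sum_{j \in G_i} \sin(\theta_j - \theta_i)$ is linearly stable if all but one of the $n$ eigenvalues (with multiplicity)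 of the Jacobian matrix of the system at $\theta$ are negative. Suppose that $G$ has a $k$-let with $k \ge 3$. Then $\dim \mathbb{V}(I_K) > 0$, and for every vertex $v_0$: (1) $\dim X_{v_0} > 0$, so positive dimension persists after the rotational symmetry is removed; (2) $X_{v_0}$ contains a continuous family of points, that is, two distinct points of $X_{v_0}$ are joined by a continuous path in $X_{v_0}$; (3) if $p_{v_0}(\theta)$, with $\theta \in \mathbb{R}^{\mathcal V}$, lies on an irreducible component of positive dimension of $X_{v_0}$, then $\theta$ is not linearly stable; likewise if $p_{v_0}(\theta)$ is joined by a continuous path in $X_{v_0}$ to a different point of $X_{v_0}$. -/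

import Mathlib

noncomputable section

namespace Kuramoto

open MvPolynomial

variable {V : Type*} [Fintype V] [DecidableEq V]

/-- Simple connected graphs all of whose vertices have degree at least two. -/
structure IsSCT (G : SimpleGraph V) [DecidableRel G.Adj] : Prop where
  connected : G.Connected
  two_le_degree : ∀ v, 2 ≤ G.degree v

/-- A `k`-let: a set of `k` distinct vertices that all have the same set of neighbours. -/
def IsKLet (G : SimpleGraph V) (k : ℕ) (S : Finset V) : Prop :=
  S.card = k ∧ ∀ v ∈ S, ∀ w ∈ S, G.neighborSet v = G.neighborSet w

/-! ### The dynamical system -/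

/-- Right-hand side of the homogeneous Kuramoto system. -/
def field (G : SimpleGraph V) [DecidableRel G.Adj] (θ : V → ℝ) (i : V) : ℝ :=
  ∑ j ∈ G.neighborFinset i, Real.sin (θ j - θ i)

def IsEquilibrium (G : SimpleGraph V) [DecidableRel G.Adj] (θ : V → ℝ) : Prop :=
  ∀ i, field G θ i = 0

/-- The Jacobian matrix of partial derivatives `∂ f_i / ∂ θ_j` at `θ`. -/
def jacobian (G : SimpleGraph V) [DecidableRel G.Adj] (θ : V → ℝ) : Matrix V V ℝ :=
  Matrix.of fun i j => deriv (fun t : ℝ => field G (Function.update θ j t) i) (θ j)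

/-- An equilibrium is linearly stable if all but one of the eigenvalues of the Jacobian, counted
with multiplicity, are negative. (The Jacobian is real symmetric, so that its characteristic
polynomial has `|V|` real roots; zero is always one of them.) -/
def LinearlyStable (G : SimpleGraph V) [DecidableRel G.Adj] (θ : V → ℝ) : Prop :=
  IsEquilibrium G θ ∧
    (jacobian G θ).charpoly.roots.countP (fun r => r < 0) + 1 = Fintype.card V

/-! ### The algebraic encoding -/

/-- The variable `x_i`, standing for `sin θ_i`. -/
def x (i : V) : MvPolynomial (V ⊕ V) ℂ := X (Sum.inl i)

/-- The variable `y_i`, standing for `cos θ_i`. -/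
def y (i : V) : MvPolynomial (V ⊕ V) ℂ := X (Sum.inr i)

/-- The ideal generated by the polynomials `x_i ^ 2 + y_i ^ 2 - 1`. -/
def idealTheta (V : Type*) : Ideal (MvPolynomial (V ⊕ V) ℂ) :=
  Ideal.span (Set.range fun i : V => x i ^ 2 + y i ^ 2 - 1)

/-- The polynomial `f_i`. -/
def f (G : SimpleGraph V) [DecidableRel G.Adj] (i : V) : MvPolynomial (V ⊕ V) ℂ :=
  ∑ j ∈ G.neighborFinset i, (x j * y i - x i * y j)

def idealG (G : SimpleGraph V) [DecidableRel G.Adj] : Ideal (MvPolynomial (V ⊕ V) ℂ) :=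
  Ideal.span (Set.range (f G))

/-- The Kuramoto oscillator ideal `I_K`. -/
def idealK (G : SimpleGraph V) [DecidableRel G.Adj] : Ideal (MvPolynomial (V ⊕ V) ℂ) :=
  idealTheta V ⊔ idealG G

/-- The Kuramoto ideal in coordinates in which the angle at `v₀` is zero, that is, `x_{v₀} = 0`
and `y_{v₀} = 1`. This removes the rotational symmetry. -/
def idealK₀ (G : SimpleGraph V) [DecidableRel G.Adj] (v₀ : V) :
    Ideal (MvPolynomial (V ⊕ V) ℂ) :=
  idealK G ⊔ Ideal.span {x v₀, y v₀ - 1}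

/-- The set of common zeros in `ℂ ^ m` of the polynomials in an ideal. -/
def variety {σ : Type*} (I : Ideal (MvPolynomial σ ℂ)) : Set (σ → ℂ) :=
  MvPolynomial.zeroLocus ℂ I

/-- The dimension of an affine variety: the Krull dimension of its coordinate ring
(`⊥` for the empty set). -/
def affineDim {σ : Type*} (Z : Set (σ → ℂ)) : WithBot ℕ∞ :=
  ringKrullDim (MvPolynomial σ ℂ ⧸ MvPolynomial.vanishingIdeal ℂ Z)

/-- The point of `ℂ ^ (2n)` encoding the angles `θ`, after the rotation that brings the angle at
`v₀` to zero. -/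
def point (v₀ : V) (θ : V → ℝ) : V ⊕ V → ℂ :=
  Sum.elim (fun i => (Real.sin (θ i - θ v₀) : ℂ)) (fun i => (Real.cos (θ i - θ v₀) : ℂ))

end Kuramoto

end

namespace Kuramoto

open MvPolynomial

variable {V : Type*} [Fintype V] [DecidableEq V]

/-! ### Points of affine varieties -/

/-! Put `u_i = y_i + I x_i`, so that `u_i⁻¹ = y_i - I x_i` and `f_i` becomes, up to a constant
factor, the sum over neighbours `j` of `u_j u_i⁻¹ - u_i u_j⁻¹`. Take three vertices of the `k`-let,
with common neighbourhood `N`. Their own equations hold as soon as `∑_N u_j = ∑_N u_j⁻¹ = 0`, and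
every other vertex sees the triple only through the sum `A` of its three units and the sum `B` of
their inverses. For any `A`, `B` such triples move in a curve (`exists_curve_sum_eq_sum_inv_eq`). It
remains to solve the equations off the triple together with the two constraints, for some `A` and
`B`: these are the Lagrange conditions for the energy of the remaining graph on the compact set `∑_N
e^{iθ_j} = 0`, with `A`, `B` encoding the multipliers (`exists_units_multipliers`). The resulting
path makes the variety infinite, hence of positive dimension.

For instability: at a linearly stable point the kernel of the Jacobian consists of the constants, so
the normalized ideal `I` has zero Zariski tangent space there, that is, `m ≤ I + m²` for the maximal
ideal `m` of the point. Nakayama's lemma then isolates the point, both for irreducible components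
and for paths. -/

lemma mem_of_X_sub_C_mem {σ : Type*} {J : Ideal (MvPolynomial σ ℂ)} {p : σ → ℂ}
    (h : ∀ i, X i - C (p i) ∈ J) {g : MvPolynomial σ ℂ} (hg : aeval p g = 0) : g ∈ J := by
  have key : Ideal.Quotient.mkₐ ℂ J = (Algebra.ofId ℂ (MvPolynomial σ ℂ ⧸ J)).comp (aeval p) := by
    ext i
    have := Ideal.Quotient.eq.mpr (h i)
    rw [AlgHom.comp_apply, aeval_X]
    exact this
  have h2 := DFunLike.congr_fun key g
  simp only [AlgHom.comp_apply, hg, map_zero] at h2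
  exact Ideal.Quotient.eq_zero_iff_mem.mp h2

lemma affineDim_singleton {σ : Type*} (p : σ → ℂ) : affineDim {p} = 0 := by
  unfold affineDim
  let := Ideal.Quotient.field (vanishingIdeal ℂ ({p} : Set (σ → ℂ)))
  exact ringKrullDim_eq_zero_of_field _

/-- A Noetherian ring of dimension at most zero is Artinian, so it has finitely many primes, whereas
distinct points of `Z` give distinct primes. -/
lemma affineDim_pos_of_infinite {σ : Type*} [Finite σ] {Z : Set (σ → ℂ)} (hZ : Z.Infinite) :
    0 < affineDim Z := by
  by_contra hle
  rw [not_lt] at hle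
  have : Ring.KrullDimLE 0 (MvPolynomial σ ℂ ⧸ vanishingIdeal ℂ Z) :=
    Ring.krullDimLE_iff.mpr (by simpa [affineDim] using hle)
  have : IsArtinianRing (MvPolynomial σ ℂ ⧸ vanishingIdeal ℂ Z) :=
    isArtinianRing_iff_isNoetherianRing_krullDimLE_zero.mpr ⟨inferInstance, this⟩
  have hmap : ∀ z : Z, ∀ g ∈ vanishingIdeal ℂ Z, aeval (z : σ → ℂ) g = 0 :=
    fun z g hg => hg z z.2
  let ev : Z → (MvPolynomial σ ℂ ⧸ vanishingIdeal ℂ Z →ₐ[ℂ] ℂ) :=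
    fun z => Ideal.Quotient.liftₐ _ (aeval (z : σ → ℂ)) (hmap z)
  let F : Z → PrimeSpectrum (MvPolynomial σ ℂ ⧸ vanishingIdeal ℂ Z) :=
    fun z => ⟨RingHom.ker (ev z), RingHom.ker_isPrime _⟩
  have hF : Function.Injective F := by
    intro z w hzw
    have hker : RingHom.ker (ev z) = RingHom.ker (ev w) := congrArg PrimeSpectrum.asIdeal hzw
    ext i
    have h1 : Ideal.Quotient.mk (vanishingIdeal ℂ Z) (X i - C ((z : σ → ℂ) i)) ∈
        RingHom.ker (ev z) := by
      rw [RingHom.mem_ker]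
      change aeval (z : σ → ℂ) (X i - C ((z : σ → ℂ) i)) = 0
      simp
    rw [hker, RingHom.mem_ker] at h1
    change aeval (w : σ → ℂ) (X i - C ((z : σ → ℂ) i)) = 0 at h1
    simp only [map_sub, aeval_X, aeval_C, Algebra.algebraMap_self, RingHom.id_apply] at h1
    exact (sub_eq_zero.mp h1).symm
  have := hZ.to_subtype
  exact not_finite_iff_infinite.mpr this (Finite.of_injective F hF)

lemma infinite_of_joinedIn {X : Type*} [TopologicalSpace X] [T1Space X] {Z : Set X} {p q : X}
    (hpq : p ≠ q) (h : JoinedIn Z p q) : Z.Infinite := by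
  have hc := isPreconnected_range h.somePath.continuous
  refine (hc.infinite_of_nontrivial ⟨p, ⟨0, by simp⟩, q, ⟨1, by simp⟩, hpq⟩).mono ?_
  rintro _ ⟨t, rfl⟩
  exact h.somePath_mem t

/-! ### Equations of the Kuramoto varieties -/

lemma mem_variety_idealK {ι : Type*} [Fintype ι] {G : SimpleGraph ι} [DecidableRel G.Adj]
    {z : ι ⊕ ι → ℂ} :
    z ∈ variety (idealK G) ↔
      (∀ i, z (.inl i) ^ 2 + z (.inr i) ^ 2 = 1) ∧
      ∀ i, ∑ j ∈ G.neighborFinset i, (z (.inl j) * z (.inr i) - z (.inl i) * z (.inr j)) = 0 := by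
  unfold variety idealK idealTheta idealG
  rw [← Ideal.span_union, zeroLocus_span]
  simp only [Set.mem_union, Set.mem_range, Set.mem_ofPred_eq, or_imp, forall_and,
    forall_exists_index, forall_apply_eq_imp_iff]
  simp [x, y, f, sub_eq_zero]

lemma mem_variety_idealK₀ {ι : Type*} [Fintype ι] {G : SimpleGraph ι} [DecidableRel G.Adj]
    {v₀ : ι} {z : ι ⊕ ι → ℂ} :
    z ∈ variety (idealK₀ G v₀) ↔
      z ∈ variety (idealK G) ∧ z (.inl v₀) = 0 ∧ z (.inr v₀) = 1 := by
  unfold idealK₀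
  have : variety (idealK G ⊔ Ideal.span {x v₀, y v₀ - 1}) =
      variety (idealK G) ∩ variety (Ideal.span {x v₀, y v₀ - 1}) :=
    (zeroLocus_vanishingIdeal_galoisConnection (k := ℂ) (K := ℂ) (σ := ι ⊕ ι)).l_sup
  rw [this, Set.mem_inter_iff]
  refine and_congr_right fun _ => ?_
  unfold variety
  rw [zeroLocus_span]
  simp [x, y, sub_eq_zero]

lemma variety_idealK₀_subset {ι : Type*} [Fintype ι] (G : SimpleGraph ι) [DecidableRel G.Adj]
    (v₀ : ι) :
    variety (idealK₀ G v₀) ⊆ variety (idealK G) :=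
  fun _ hz => (mem_variety_idealK₀.mp hz).1

/-! ### The Jacobian -/

lemma jacobian_apply (G : SimpleGraph V) [DecidableRel G.Adj] (θ : V → ℝ) (i k : V) :
    jacobian G θ i k = ∑ j ∈ G.neighborFinset i, Real.cos (θ j - θ i) *
      ((Pi.single k 1 : V → ℝ) j - (Pi.single k 1 : V → ℝ) i) := by
  have hu : ∀ j, HasDerivAt (fun t => Function.update θ k t j)
      ((Pi.single k 1 : V → ℝ) j) (θ k) :=
    fun j => hasDerivAt_pi.mp (hasDerivAt_update θ k (θ k)) j
  have h : HasDerivAt (fun t : ℝ => field G (Function.update θ k t) i)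
      (∑ j ∈ G.neighborFinset i, Real.cos (θ j - θ i) *
        ((Pi.single k 1 : V → ℝ) j - (Pi.single k 1 : V → ℝ) i)) (θ k) := by
    unfold field
    refine HasDerivAt.fun_sum fun j _ => ?_
    simpa using ((hu j).sub (hu i)).sin
  exact h.deriv

lemma jacobian_map_mulVec (G : SimpleGraph V) [DecidableRel G.Adj] (θ : V → ℝ)
    {A : Type*} [CommRing A] (φ : ℝ →+* A) (τ : V → A) (i : V) :
    ((jacobian G θ).map φ).mulVec τ i =
      ∑ j ∈ G.neighborFinset i, φ (Real.cos (θ j - θ i)) * (τ j - τ i) := by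
  have hs : ∀ l : V, ∑ k, φ ((Pi.single k 1 : V → ℝ) l) * τ k = τ l := by
    intro l
    rw [Finset.sum_eq_single l]
    · simp
    · intro k _ hk
      simp [hk.symm]
    · simp
  simp only [Matrix.mulVec, dotProduct, Matrix.map_apply, jacobian_apply, map_sum, map_mul,
    map_sub, Finset.sum_mul]
  rw [Finset.sum_comm]
  refine Finset.sum_congr rfl fun j _ => ?_
  simp only [mul_assoc, sub_mul, ← Finset.mul_sum, Finset.sum_sub_distrib, hs]

lemma jacobian_mulVec (G : SimpleGraph V) [DecidableRel G.Adj] (θ τ : V → ℝ) (i : V) :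
    (jacobian G θ).mulVec τ i =
      ∑ j ∈ G.neighborFinset i, Real.cos (θ j - θ i) * (τ j - τ i) := by
  simpa using jacobian_map_mulVec G θ (RingHom.id ℝ) τ i

lemma sum_jacobian_mulVec (G : SimpleGraph V) [DecidableRel G.Adj] (θ τ : V → ℝ) :
    ∑ i, (jacobian G θ).mulVec τ i = 0 := by
  simp only [jacobian_mulVec, SimpleGraph.neighborFinset_eq_filter, Finset.sum_filter]
  have h : ∑ i, ∑ j, (if G.Adj i j then Real.cos (θ j - θ i) * (τ j - τ i) else 0) =
      -∑ i, ∑ j, (if G.Adj i j then Real.cos (θ j - θ i) * (τ j - τ i) else 0) := by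
    conv_lhs => rw [Finset.sum_comm]
    rw [← Finset.sum_neg_distrib]
    refine Finset.sum_congr rfl fun i _ => ?_
    rw [← Finset.sum_neg_distrib]
    refine Finset.sum_congr rfl fun j _ => ?_
    rw [← Real.cos_neg (θ i - θ j), neg_sub]
    simp only [G.adj_comm j i]
    split_ifs <;> ring
  linarith

/-- The root count leaves at most one nonnegative root, so zero has algebraic, hence geometric,
multiplicity at most one; the constants already lie in the kernel. -/
lemma LinearlyStable.eq_of_mulVec_eq_zero {G : SimpleGraph V} [DecidableRel G.Adj] {θ : V → ℝ}
    (h : LinearlyStable G θ) {τ : V → ℝ} (hτ : (jacobian G θ).mulVec τ = 0) (i j : V) :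
    τ i = τ j := by
  set A := jacobian G θ
  have hmult : A.charpoly.rootMultiplicity 0 ≤ 1 := by
    rw [← Polynomial.count_roots]
    have h1 := A.charpoly.card_roots'
    rw [Matrix.charpoly_natDegree_eq_dim, Multiset.card_eq_countP_add_countP (fun r => r < 0)] at h1
    have h2 : A.charpoly.roots.count 0 ≤ A.charpoly.roots.countP (fun r => ¬ r < 0) := by
      rw [Multiset.count, Multiset.countP_eq_card_filter, Multiset.countP_eq_card_filter]
      exact Multiset.card_le_card
        (Multiset.monotone_filter_right _ fun r hr => by simp [← hr])
    have h3 : A.charpoly.roots.countP (fun r => r < 0) + 1 = Fintype.card V := h.2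
    omega
  have hrank : Module.finrank ℝ (Module.End.eigenspace (Matrix.toLin' A) 0) ≤ 1 := by
    refine (LinearMap.finrank_eigenspace_le _ _).trans ?_
    rwa [Matrix.charpoly_toLin']
  obtain ⟨v, hv⟩ := finrank_le_one_iff.mp hrank
  have hmem : ∀ w : V → ℝ, A.mulVec w = 0 → w ∈ Module.End.eigenspace (Matrix.toLin' A) 0 := by
    intro w hw
    rw [Module.End.mem_eigenspace_iff]
    simpa using hw
  have hone : A.mulVec (fun _ => 1) = 0 := by
    ext l
    simp [A, jacobian_mulVec]
  obtain ⟨c, hc⟩ := hv ⟨_, hmem _ hone⟩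
  obtain ⟨d, hd⟩ := hv ⟨_, hmem _ hτ⟩
  have hc' : ∀ l, c * (v : V → ℝ) l = 1 := fun l => congrFun (congrArg Subtype.val hc) l
  have hd' : ∀ l, d * (v : V → ℝ) l = τ l := fun l => congrFun (congrArg Subtype.val hd) l
  have hc0 : c ≠ 0 := by
    rintro rfl
    simpa using hc' i
  have : (v : V → ℝ) i = (v : V → ℝ) j := mul_left_cancel₀ hc0 ((hc' i).trans (hc' j).symm)
  rw [← hd', ← hd', this]

/-- Adding `τ v₀` to every row makes the matrix invertible over `ℝ`, and an inverse survives base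
change. General `A` is needed because `τ` will live in a quotient of the polynomial ring. -/
lemma LinearlyStable.eq_zero_of_map_mulVec_eq_zero {G : SimpleGraph V} [DecidableRel G.Adj]
    {θ : V → ℝ} (h : LinearlyStable G θ) {A : Type*} [CommRing A] (φ : ℝ →+* A) (v₀ : V)
    {τ : V → A} (hτ : ((jacobian G θ).map φ).mulVec τ = 0) (h₀ : τ v₀ = 0) : τ = 0 := by
  set E : Matrix V V ℝ := Matrix.of fun _ j => (Pi.single v₀ 1 : V → ℝ) j with hE
  set J' := jacobian G θ + E with hJ'
  have hEmul : ∀ τ : V → ℝ, ∀ i, E.mulVec τ i = τ v₀ := by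
    intro τ i
    simp [hE, Matrix.mulVec, dotProduct, Pi.single_apply]
  have hdet : J'.det ≠ 0 := by
    intro hdet
    obtain ⟨w, hw0, hw⟩ := Matrix.exists_mulVec_eq_zero_iff.mpr hdet
    rw [hJ', Matrix.add_mulVec] at hw
    -- The Jacobian part sums to zero over the rows, which leaves `|V| * w v₀ = 0`.
    have hsum : ∑ i, ((jacobian G θ).mulVec w + E.mulVec w) i = 0 := by rw [hw]; simp
    simp only [Pi.add_apply, Finset.sum_add_distrib, sum_jacobian_mulVec, hEmul,
      Finset.sum_const, zero_add, nsmul_eq_mul, Finset.card_univ] at hsum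
    have : Nonempty V := ⟨v₀⟩
    have hw₀ : w v₀ = 0 := by
      rcases mul_eq_zero.mp hsum with h | h
      · exact absurd h (by exact_mod_cast Fintype.card_ne_zero)
      · exact h
    have hE0 : E.mulVec w = 0 := funext fun i => by rw [hEmul, hw₀]; rfl
    rw [hE0, add_zero] at hw
    exact hw0 (funext fun i => (h.eq_of_mulVec_eq_zero hw i v₀).trans hw₀)
  have hJτ : (J'.map φ).mulVec τ = 0 := by
    rw [hJ', Matrix.map_add _ (map_add φ), Matrix.add_mulVec, hτ, zero_add]
    ext i
    simp [hE, Matrix.mulVec, dotProduct, Pi.single_apply, apply_ite φ, h₀]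
  have hinv : J'⁻¹ * J' = 1 := Matrix.nonsing_inv_mul _ (isUnit_iff_ne_zero.mpr hdet)
  calc τ = ((J'⁻¹ * J').map φ).mulVec τ := by
        rw [hinv, Matrix.map_one _ (map_zero φ) (map_one φ), Matrix.one_mulVec]
    _ = 0 := by rw [Matrix.map_mul, ← Matrix.mulVec_mulVec, hJτ, Matrix.mulVec_zero]

/-! ### Linearly stable equilibria are isolated -/

/-- Vanishing of the tangent space, with `K` playing the role of `I + m²`. Modulo `K` the
displacements `ξ`, `η` have vanishing products; the circle equations make them tangential, `(ξ, η) =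
τ (b, -a)`, and the linear part of `f_i` is the Jacobian applied to the infinitesimal rotation
angles `τ`. -/
lemma LinearlyStable.X_sub_C_mem {G : SimpleGraph V} [DecidableRel G.Adj] {θ : V → ℝ}
    (h : LinearlyStable G θ) (v₀ : V) (hp : point v₀ θ ∈ variety (idealK₀ G v₀))
    {K : Ideal (MvPolynomial (V ⊕ V) ℂ)} (hIK : idealK₀ G v₀ ≤ K)
    (hK : ∀ s t, (X s - C (point v₀ θ s)) * (X t - C (point v₀ θ t)) ∈ K) (s : V ⊕ V) :
    X s - C (point v₀ θ s) ∈ K := by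
  set p := point v₀ θ with hpdef
  set mk := Ideal.Quotient.mk K with hmk
  set α : ℂ →+* (MvPolynomial (V ⊕ V) ℂ ⧸ K) := mk.comp C with hα
  set ξ : V → (MvPolynomial (V ⊕ V) ℂ ⧸ K) := fun i => mk (X (.inl i) - C (p (.inl i))) with hξ
  set η : V → (MvPolynomial (V ⊕ V) ℂ ⧸ K) := fun i => mk (X (.inr i) - C (p (.inr i))) with hη
  set a : V → (MvPolynomial (V ⊕ V) ℂ ⧸ K) := fun i => α (p (.inl i)) with ha
  set b : V → (MvPolynomial (V ⊕ V) ℂ ⧸ K) := fun i => α (p (.inr i)) with hb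
  have hx : ∀ i, mk (x i) = ξ i + a i := fun i => by simp [hξ, ha, hα, x]
  have hy : ∀ i, mk (y i) = η i + b i := fun i => by simp [hη, hb, hα, y]
  have hmul : ∀ s t, mk (X s - C (p s)) * mk (X t - C (p t)) = 0 := fun s t => by
    rw [← map_mul]; exact Ideal.Quotient.eq_zero_iff_mem.mpr (hK s t)
  have hz : ∀ g ∈ idealK₀ G v₀, mk g = 0 := fun g hg =>
    Ideal.Quotient.eq_zero_iff_mem.mpr (hIK hg)
  obtain ⟨hpK, -, -⟩ := mem_variety_idealK₀.mp hp
  obtain ⟨hp1, hp2⟩ := mem_variety_idealK.mp hpK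
  have hab : ∀ i, a i ^ 2 + b i ^ 2 = 1 := fun i => by
    simp only [ha, hb, ← map_pow, ← map_add, hp1, map_one]
  have htwo : α (1 / 2) * 2 = 1 := by
    rw [← map_ofNat α 2, ← map_mul]; norm_num
  have hlin : ∀ i, a i * ξ i + b i * η i = 0 := fun i => by
    have h1 : mk (x i ^ 2 + y i ^ 2 - 1) = 0 := hz _ <|
      Ideal.mem_sup_left <| Ideal.mem_sup_left <| Ideal.subset_span ⟨i, rfl⟩
    simp only [map_sub, map_add, map_pow, map_one, hx, hy] at h1
    have h2 := hmul (.inl i) (.inl i)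
    have h3 := hmul (.inr i) (.inr i)
    change ξ i * ξ i = 0 at h2
    change η i * η i = 0 at h3
    linear_combination α (1 / 2) * (h1 - h2 - h3 - hab i) - (a i * ξ i + b i * η i) * htwo
  set τ : V → (MvPolynomial (V ⊕ V) ℂ ⧸ K) := fun i => b i * ξ i - a i * η i with hτ
  have hξτ : ∀ i, ξ i = b i * τ i := fun i => by
    simp only [hτ]; linear_combination a i * hlin i - ξ i * hab i
  have hητ : ∀ i, η i = -a i * τ i := fun i => by
    simp only [hτ]; linear_combination b i * hlin i - η i * hab i
  have hτ₀ : τ v₀ = 0 := by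
    have h1 : mk (x v₀) = 0 := hz _ <| Ideal.mem_sup_right <| Ideal.subset_span (by simp)
    have h2 : mk (y v₀ - 1) = 0 := hz _ <| Ideal.mem_sup_right <| Ideal.subset_span (by simp)
    rw [hx] at h1
    rw [map_sub, hy, map_one] at h2
    have ha0 : a v₀ = 0 := by simp [ha, hpdef, point]
    simp only [hτ]
    linear_combination b v₀ * h1 - a v₀ * h2 - ha0
  have hcos : ∀ i j, α ((Real.cos (θ j - θ i) : ℝ) : ℂ) = a j * a i + b j * b i := fun i j => by
    simp only [ha, hb, ← map_mul, ← map_add]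
    congr 1
    simp only [hpdef, point, Sum.elim_inl, Sum.elim_inr]
    rw [show θ j - θ i = (θ j - θ v₀) - (θ i - θ v₀) by ring, Real.cos_sub]
    push_cast
    ring
  have hJ : ((jacobian G θ).map (α.comp Complex.ofRealHom)).mulVec τ = 0 := by
    ext i
    rw [jacobian_map_mulVec]
    have h1 : mk (f G i) = 0 := hz _ <|
      Ideal.mem_sup_left <| Ideal.mem_sup_right <| Ideal.subset_span ⟨i, rfl⟩
    have h2 := congrArg α (hp2 i)
    simp only [f, map_sum, map_sub, map_mul, hx, hy, map_zero] at h1 h2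
    refine Eq.trans ?_ ((congrArg₂ (· - ·) h1 h2).trans (sub_zero 0))
    rw [← Finset.sum_sub_distrib]
    refine Finset.sum_congr rfl fun j _ => ?_
    simp only [RingHom.comp_apply, Complex.ofRealHom_eq_coe, hcos]
    have h3 : ξ j * η i = 0 := hmul _ _
    have h4 : ξ i * η j = 0 := hmul _ _
    have h5 : ∀ l, α (p (.inl l)) = a l := fun _ => rfl
    have h6 : ∀ l, α (p (.inr l)) = b l := fun _ => rfl
    rw [h5, h5, h6, h6]
    linear_combination h4 - h3 - b i * hξτ j - a j * hητ i + b j * hξτ i + a i * hητ j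
  have hτ0 := h.eq_zero_of_map_mulVec_eq_zero _ v₀ hJ hτ₀
  rw [← Ideal.Quotient.eq_zero_iff_mem]
  rcases s with i | i
  · exact (hξτ i).trans (by simp [hτ0])
  · exact (hητ i).trans (by simp [hτ0])

/-- Nakayama's lemma applied to `m ≤ I + m²` gives `r ≡ 1` modulo `m` with `r m ≤ I`: where `r ≠ 0`,
the only zero of `I` is the point itself. -/
lemma LinearlyStable.exists_mul_X_sub_C_mem {G : SimpleGraph V} [DecidableRel G.Adj] {θ : V → ℝ}
    (h : LinearlyStable G θ) (v₀ : V) (hp : point v₀ θ ∈ variety (idealK₀ G v₀)) :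
    ∃ r : MvPolynomial (V ⊕ V) ℂ, aeval (point v₀ θ) r ≠ 0 ∧
      ∀ s, r * (X s - C (point v₀ θ s)) ∈ idealK₀ G v₀ := by
  set m := vanishingIdeal ℂ ({point v₀ θ} : Set (V ⊕ V → ℂ)) with hm
  have hXm : ∀ s, X s - C (point v₀ θ s) ∈ m := fun s => by
    rw [hm, mem_vanishingIdeal_singleton_iff]; simp
  have hle : m ≤ idealK₀ G v₀ ⊔ m • m := fun g hg =>
    mem_of_X_sub_C_mem (h.X_sub_C_mem v₀ hp le_sup_left fun s t =>
      Ideal.mem_sup_right (Ideal.mul_mem_mul (hXm s) (hXm t)))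
      ((mem_vanishingIdeal_singleton_iff _ _).mp hg)
  obtain ⟨r, hr, hrm⟩ := Submodule.exists_sub_one_mem_and_smul_le_of_fg_of_le_sup
    (IsNoetherian.noetherian m) le_rfl hle
  refine ⟨r, fun h0 => ?_, fun s => hrm (Submodule.smul_mem_pointwise_smul _ _ _ (hXm s))⟩
  rw [hm, mem_vanishingIdeal_singleton_iff] at hr
  rw [map_sub, h0, map_one] at hr
  simp at hr

lemma LinearlyStable.affineDim_eq_zero {G : SimpleGraph V} [DecidableRel G.Adj] {θ : V → ℝ}
    (h : LinearlyStable G θ) (v₀ : V) {P : Ideal (MvPolynomial (V ⊕ V) ℂ)} [hP : P.IsPrime]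
    (hIP : idealK₀ G v₀ ≤ P) (hp : point v₀ θ ∈ variety P) : affineDim (variety P) = 0 := by
  obtain ⟨r, hr, hrI⟩ := h.exists_mul_X_sub_C_mem v₀ (zeroLocus_anti_mono hIP hp)
  have hrP : r ∉ P := fun hrP => hr (hp r hrP)
  have hX : ∀ s, X s - C (point v₀ θ s) ∈ P := fun s =>
    (hP.mem_or_mem (hIP (hrI s))).resolve_left hrP
  have : variety P = {point v₀ θ} := by
    refine Set.eq_singleton_iff_unique_mem.mpr ⟨hp, fun q hq => funext fun s => ?_⟩
    simpa [sub_eq_zero] using hq _ (hX s)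
  rw [this, affineDim_singleton]

lemma LinearlyStable.eq_of_joinedIn {G : SimpleGraph V} [DecidableRel G.Adj] {θ : V → ℝ}
    (h : LinearlyStable G θ) (v₀ : V) {q : V ⊕ V → ℂ}
    (hq : JoinedIn (variety (idealK₀ G v₀)) (point v₀ θ) q) : q = point v₀ θ := by
  obtain ⟨r, hr, hrI⟩ := h.exists_mul_X_sub_C_mem v₀ hq.source_mem
  set γ := hq.somePath
  have hγ : ∀ t, aeval (γ t) r ≠ 0 ↔ γ t = point v₀ θ := by
    refine fun t => ⟨fun ht => funext fun s => ?_, fun ht => by rwa [ht]⟩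
    have := hq.somePath_mem t _ (hrI s)
    rw [map_mul] at this
    simpa [sub_eq_zero] using (mul_eq_zero.mp this).resolve_left ht
  have hcont : Continuous fun t => aeval (γ t) r := by
    simp only [aeval_eq_eval]
    exact (continuous_eval r).comp γ.continuous
  -- Closed as an equality, open because by `hγ` it is the locus `r ≠ 0` along the path.
  have hclopen : IsClopen {t | γ t = point v₀ θ} := by
    refine ⟨isClosed_eq γ.continuous continuous_const, ?_⟩
    simp only [← hγ]
    exact isOpen_ne_fun hcont continuous_const
  have huniv := hclopen.eq_univ ⟨0, γ.source⟩
  have : (1 : unitInterval) ∈ {t | γ t = point v₀ θ} := huniv ▸ Set.mem_univ _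
  simpa using this

/-! ### Triples of units with prescribed sum and sum of inverses -/

/-- If one unit is `t`, the other two have sum `A - t` and product `(A - t) / (B - t⁻¹)`; the last
condition is that their quadratic has nonzero discriminant. -/
lemma exists_generic_parameter (A B : ℂ) :
    ∃ t : ℂ, t ≠ 0 ∧ A - t ≠ 0 ∧ B - t⁻¹ ≠ 0 ∧ (A - t) ^ 2 - 4 * ((A - t) / (B - t⁻¹)) ≠ 0 := by
  classical
  set P : Polynomial ℂ := (Polynomial.C A - Polynomial.X) * (Polynomial.C B * Polynomial.X - 1) -
    4 * Polynomial.X with hP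
  have h1 : (Polynomial.C A - Polynomial.X) ≠ 0 := by
    intro h
    simpa using congrArg (Polynomial.coeff · 1) h
  have h2 : (Polynomial.C B * Polynomial.X - 1) ≠ 0 := by
    intro h
    simpa using congrArg (Polynomial.eval 0) h
  have h3 : P ≠ 0 := by
    intro h
    -- Vanishing at `0`, `1` and `-1` would force `A = 0`, then both `B = -3` and `B = 3`.
    have e0 := congrArg (Polynomial.eval 0) h
    have e1 := congrArg (Polynomial.eval 1) h
    have e2 := congrArg (Polynomial.eval (-1)) h
    simp [hP] at e0 e1 e2
    subst e0
    have : (6 : ℂ) = 0 := by linear_combination e2 - e1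
    norm_num at this
  have h4 : Polynomial.X * (Polynomial.C A - Polynomial.X) *
      (Polynomial.C B * Polynomial.X - 1) * P ≠ 0 :=
    mul_ne_zero (mul_ne_zero (mul_ne_zero Polynomial.X_ne_zero h1) h2) h3
  obtain ⟨t, ht⟩ := Polynomial.exists_eval_ne_zero_of_natDegree_lt_card _ h4
    (by simp [Cardinal.mk_complex, Cardinal.natCast_lt_aleph0.trans_le Cardinal.aleph0_le_continuum])
  simp only [Polynomial.eval_mul, Polynomial.eval_X, Polynomial.eval_sub, Polynomial.eval_C,
    Polynomial.eval_one, hP, Polynomial.eval_ofNat, mul_ne_zero_iff] at ht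
  obtain ⟨⟨⟨t0, ht1⟩, ht2⟩, ht3⟩ := ht
  have hr : B - t⁻¹ = (B * t - 1) / t := by field_simp
  have hr0 : B - t⁻¹ ≠ 0 := by rw [hr]; exact div_ne_zero ht2 t0
  refine ⟨t, t0, ht1, hr0, fun h => ht3 ?_⟩
  rw [hr, div_div_eq_mul_div] at h
  have h5 : (A - t) * ((A - t) * (B * t - 1) - 4 * t) = 0 := by
    linear_combination (B * t - 1) * h + 4 * div_mul_cancel₀ ((A - t) * t) ht2
  exact (mul_eq_zero.mp h5).resolve_left ht1

lemma exists_curve_sum_eq_sum_inv_eq (A B : ℂ) :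
    ∃ u v w : ℝ → ℂ, ContinuousOn u unitInterval ∧ ContinuousOn v unitInterval ∧
      ContinuousOn w unitInterval ∧ u 0 ≠ u 1 ∧ ∀ t ∈ unitInterval,
        u t ≠ 0 ∧ v t ≠ 0 ∧ w t ≠ 0 ∧ u t + v t + w t = A ∧
        (u t)⁻¹ + (v t)⁻¹ + (w t)⁻¹ = B := by
  obtain ⟨t₀, h0, h1, h2, h3⟩ := exists_generic_parameter A B
  set s : ℂ → ℂ := fun t => A - t with hs
  set r : ℂ → ℂ := fun t => B - t⁻¹ with hr
  set d : ℂ → ℂ := fun t => s t ^ 2 - 4 * (s t / r t) with hd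
  have hrc : ContinuousAt r t₀ := continuousAt_const.sub (continuousAt_id.inv₀ h0)
  have hsc : ContinuousAt s t₀ := continuousAt_const.sub continuousAt_id
  have hdc : ContinuousAt d t₀ :=
    (hsc.pow 2).sub (continuousAt_const.mul (hsc.div hrc h2))
  have hd0 : d t₀ ≠ 0 := h3
  obtain ⟨σ₀, hσ₀⟩ := IsAlgClosed.exists_pow_nat_eq (d t₀) (n := 2) (by norm_num)
  have hnear : ∀ᶠ t in nhds t₀, t ≠ 0 ∧ s t ≠ 0 ∧ r t ≠ 0 ∧ d t / d t₀ ∈ Complex.slitPlane := by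
    refine (continuousAt_id.eventually_ne h0).and ((hsc.eventually_ne h1).and
      ((hrc.eventually_ne h2).and ?_))
    refine (hdc.div_const (d t₀)).eventually_mem (Complex.isOpen_slitPlane.mem_nhds ?_)
    rw [div_self hd0]
    exact Complex.one_mem_slitPlane
  obtain ⟨ε, hε, hball⟩ := Metric.eventually_nhds_iff_ball.mp hnear
  set u : ℝ → ℂ := fun t => t₀ + (t * (ε / 2) : ℝ) with hu
  have hmem : ∀ t ∈ unitInterval, u t ∈ Metric.ball t₀ ε := by
    intro t ht
    rw [mem_ball_iff_norm, hu, add_sub_cancel_left, Complex.norm_real, Real.norm_eq_abs,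
      abs_of_nonneg (by have := ht.1; positivity)]
    have := ht.2
    nlinarith
  have huc : Continuous u := by fun_prop
  -- A continuous square root of the discriminant: near `t₀` the ratio `d / d t₀` stays in the slit
  -- plane.
  set σ : ℝ → ℂ := fun t => σ₀ * (d (u t) / d t₀) ^ (1 / 2 : ℂ) with hσ
  have hσsq : ∀ t, σ t ^ 2 = d (u t) := by
    intro t
    rw [hσ]
    simp only
    rw [mul_pow, hσ₀, ← Complex.cpow_nat_mul]
    norm_num
    field_simp
  have hsu : ContinuousOn (fun t => s (u t)) unitInterval := (continuous_const.sub huc).continuousOn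
  have hru : ContinuousOn (fun t => r (u t)) unitInterval :=
    continuousOn_const.sub (huc.continuousOn.inv₀ fun t ht => (hball _ (hmem t ht)).1)
  have hdu : ContinuousOn (fun t => d (u t)) unitInterval :=
    (hsu.pow 2).sub (continuousOn_const.mul
      (hsu.div hru fun t ht => (hball _ (hmem t ht)).2.2.1))
  have hσc : ContinuousOn σ unitInterval :=
    continuousOn_const.mul ((hdu.div_const _).cpow_const fun t ht => (hball _ (hmem t ht)).2.2.2)
  refine ⟨u, fun t => (s (u t) + σ t) / 2, fun t => (s (u t) - σ t) / 2, huc.continuousOn,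
    (hsu.add hσc).div_const _, (hsu.sub hσc).div_const _, ?_, fun t ht => ?_⟩
  · intro h
    simp [hu] at h
    exact hε.ne' h
  · obtain ⟨g0, g1, g2, -⟩ := hball _ (hmem t ht)
    have hprod : (s (u t) + σ t) / 2 * ((s (u t) - σ t) / 2) = s (u t) / r (u t) := by
      have : d (u t) = s (u t) ^ 2 - 4 * (s (u t) / r (u t)) := rfl
      linear_combination (-1 / 4) * hσsq t - (1 / 4) * this
    have hne := mul_ne_zero_iff.mp (hprod.trans_ne (div_ne_zero g1 g2))
    refine ⟨g0, hne.1, hne.2, ?_, ?_⟩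
    · simp only [hs]; ring
    · have h5 : ((s (u t) + σ t) / 2)⁻¹ + ((s (u t) - σ t) / 2)⁻¹ = r (u t) := by
        rw [inv_add_inv hne.1 hne.2, hprod]
        field_simp
        ring
      rw [add_assoc, h5]
      simp [hr]

/-! ### Constrained equilibria -/

/-- Place the `m`-th roots of unity on `N`; they sum to zero because `m ≥ 2`. -/
lemma exists_sum_sin_cos_eq_zero {ι : Type*} [DecidableEq ι] (N : Finset ι) (hN : 2 ≤ N.card) :
    ∃ θ : ι → ℝ, ∑ j ∈ N, Real.sin (θ j) = 0 ∧ ∑ j ∈ N, Real.cos (θ j) = 0 := by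
  set m := N.card with hm
  have hm0 : (m : ℂ) ≠ 0 := by exact_mod_cast (by omega : m ≠ 0)
  have hζ := Complex.isPrimitiveRoot_exp m (by omega)
  set g : ℕ → ℝ := fun k => 2 * Real.pi * k / m with hg
  have hgexp : ∀ k, Complex.exp (g k * Complex.I) =
      Complex.exp (2 * Real.pi * Complex.I / m) ^ k := by
    intro k
    rw [← Complex.exp_nat_mul]
    congr 1
    simp only [hg]
    push_cast
    ring
  have hsum : ∑ k : Fin m, Complex.exp (g k * Complex.I) = 0 := by
    simp only [hgexp]
    rw [Fin.sum_univ_eq_sum_range (fun k => Complex.exp (2 * Real.pi * Complex.I / m) ^ k) m]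
    exact hζ.geom_sum_eq_zero (by omega)
  set θ : ι → ℝ := fun v => if h : v ∈ N then g (N.equivFin ⟨v, h⟩) else 0 with hθ
  have hsumN : ∑ j ∈ N, Complex.exp (θ j * Complex.I) = 0 := by
    rw [← hsum, ← Finset.sum_coe_sort N]
    refine Fintype.sum_equiv N.equivFin _ _ fun j => ?_
    simp [hθ]
  refine ⟨θ, ?_, ?_⟩
  · simpa [Complex.exp_ofReal_mul_I_im] using congrArg Complex.im hsumN
  · simpa [Complex.exp_ofReal_mul_I_re] using congrArg Complex.re hsumN

lemma sum_ne_zero_of_odd_card {ι : Type*} {N : Finset ι} (hN : Odd N.card) {ρ : ℝ} (hρ : ρ ≠ 0)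
    {q : ι → ℝ} (hq : ∀ j ∈ N, q j = ρ ∨ q j = -ρ) : ∑ j ∈ N, q j ≠ 0 := by
  classical
  intro h
  set e : ι → ℤ := fun j => if q j = ρ then 0 else 1 with he
  have hqe : ∀ j ∈ N, q j = ρ * ((1 - 2 * e j : ℤ) : ℝ) := by
    intro j hj
    simp only [he]
    split_ifs with h1
    · simp [h1]
    · rw [(hq j hj).resolve_left h1]; norm_num
  rw [Finset.sum_congr rfl hqe, ← Finset.mul_sum] at h
  have h2 : ∑ j ∈ N, (1 - 2 * e j) = 0 := by exact_mod_cast (mul_eq_zero.mp h).resolve_left hρ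
  rw [Finset.sum_sub_distrib, ← Finset.mul_sum] at h2
  obtain ⟨m, hm⟩ := hN
  simp only [Finset.sum_const, nsmul_eq_mul, mul_one, hm] at h2
  push_cast at h2
  omega

lemma exists_maximum_of_constraint (W : V → V → ℝ) (N : Finset V) (hN : 2 ≤ N.card) :
    ∃ θ : V → ℝ, (∑ j ∈ N, Real.sin (θ j) = 0 ∧ ∑ j ∈ N, Real.cos (θ j) = 0) ∧
      ∀ ψ : V → ℝ, ∑ j ∈ N, Real.sin (ψ j) = 0 → ∑ j ∈ N, Real.cos (ψ j) = 0 →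
        ∑ i, ∑ j, W i j * Real.cos (ψ i - ψ j) ≤ ∑ i, ∑ j, W i j * Real.cos (θ i - θ j) := by
  -- Reducing angles modulo `2π` confines the problem to a compact box without changing energy or
  -- constraints.
  set red : (V → ℝ) → (V → ℝ) := fun θ i => ((θ i : ℝ) : Real.Angle).toReal with hred
  have hsin : ∀ θ i, Real.sin (red θ i) = Real.sin (θ i) := fun θ i => by
    simp [hred, Real.Angle.sin_toReal]
  have hcos : ∀ θ i, Real.cos (red θ i) = Real.cos (θ i) := fun θ i => by
    simp [hred, Real.Angle.cos_toReal]
  set K : Set (V → ℝ) := Set.univ.pi (fun _ => Set.Icc (-Real.pi) Real.pi) ∩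
    {θ | ∑ j ∈ N, Real.sin (θ j) = 0 ∧ ∑ j ∈ N, Real.cos (θ j) = 0} with hK
  have hredK : ∀ θ : V → ℝ, ∑ j ∈ N, Real.sin (θ j) = 0 → ∑ j ∈ N, Real.cos (θ j) = 0 →
      red θ ∈ K := fun θ h1 h2 => by
    refine ⟨fun i _ => ⟨(Real.Angle.neg_pi_lt_toReal _).le, Real.Angle.toReal_le_pi _⟩, ?_, ?_⟩
    · simpa only [hsin] using h1
    · simpa only [hcos] using h2
  have hKc : IsCompact K := by
    refine (isCompact_univ_pi fun _ => isCompact_Icc).inter_right ?_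
    exact (isClosed_eq (by fun_prop) continuous_const).inter
      (isClosed_eq (by fun_prop) continuous_const)
  obtain ⟨θ₁, h1, h2⟩ := exists_sum_sin_cos_eq_zero N hN
  obtain ⟨θ, hθK, hmax⟩ := hKc.exists_isMaxOn ⟨_, hredK _ h1 h2⟩
    (f := fun θ => ∑ i, ∑ j, W i j * Real.cos (θ i - θ j)) (by fun_prop)
  refine ⟨θ, hθK.2, fun ψ h3 h4 => ?_⟩
  have := hmax (hredK ψ h3 h4)
  simpa only [Set.mem_ofPred_eq, Real.cos_sub, hsin, hcos] using this

lemma exists_multipliers_of_odd (W : V → V → ℝ) (hW : ∀ i j, W i j = W j i) (N : Finset V)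
    (hN : 2 ≤ N.card) (hodd : Odd N.card) :
    ∃ (θ : V → ℝ) (a b : ℝ), ∑ j ∈ N, Real.sin (θ j) = 0 ∧ ∑ j ∈ N, Real.cos (θ j) = 0 ∧
      ∀ k, ∑ j, W k j * Real.sin (θ j - θ k) +
        (if k ∈ N then a * Real.cos (θ k) - b * Real.sin (θ k) else 0) = 0 := by
  obtain ⟨θ, ⟨hs, hc⟩, hmax⟩ := exists_maximum_of_constraint W N hN
  refine ⟨θ, ?_⟩
  set pr : V → ((V → ℝ) →L[ℝ] ℝ) := fun i => ContinuousLinearMap.proj i with hpr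
  set F : Bool → (V → ℝ) → ℝ := fun c ψ =>
    if c then ∑ j ∈ N, Real.sin (ψ j) else ∑ j ∈ N, Real.cos (ψ j) with hF
  set F' : Bool → ((V → ℝ) →L[ℝ] ℝ) := fun c =>
    if c then ∑ j ∈ N, Real.cos (θ j) • pr j else ∑ j ∈ N, (-Real.sin (θ j)) • pr j with hF'
  have hFd : ∀ c, HasStrictFDerivAt (F c) (F' c) θ := by
    rintro (_ | _)
    · simpa [hF, hF'] using HasStrictFDerivAt.fun_sum (u := N) (x := θ)
        fun j _ => (hasStrictFDerivAt_apply (𝕜 := ℝ) j θ).cos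
    · simpa [hF, hF'] using HasStrictFDerivAt.fun_sum (u := N) (x := θ)
        fun j _ => (hasStrictFDerivAt_apply (𝕜 := ℝ) j θ).sin
  have hφ : HasStrictFDerivAt (fun ψ : V → ℝ => ∑ i, ∑ j, W i j * Real.cos (ψ i - ψ j))
      (∑ i, ∑ j, W i j • ((-Real.sin (θ i - θ j)) • (pr i - pr j))) θ :=
    HasStrictFDerivAt.fun_sum fun i _ => HasStrictFDerivAt.fun_sum fun j _ =>
      (((hasStrictFDerivAt_apply (𝕜 := ℝ) i θ).sub
        (hasStrictFDerivAt_apply (𝕜 := ℝ) j θ)).cos).const_mul (W i j)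
  have hextr : IsLocalExtrOn (fun ψ : V → ℝ => ∑ i, ∑ j, W i j * Real.cos (ψ i - ψ j))
      {ψ | ∀ c, F c ψ = F c θ} θ := by
    refine Or.inr (IsMaxOn.localize fun ψ hψ => hmax ψ ?_ ?_)
    · simpa [hF, hs] using hψ true
    · simpa [hF, hc] using hψ false
  obtain ⟨Λ, Λ₀, hΛ, hsum⟩ := hextr.exists_multipliers_of_hasStrictFDerivAt hFd hφ
  have hk : ∀ k, 2 * Λ₀ * ∑ j, W k j * Real.sin (θ j - θ k) +
      (if k ∈ N then Λ true * Real.cos (θ k) - Λ false * Real.sin (θ k) else 0) = 0 := by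
    intro k
    have h := DFunLike.congr_fun hsum (Pi.single k 1 : V → ℝ)
    have e1 : (∑ i, ∑ j, W i j • ((-Real.sin (θ i - θ j)) • (pr i - pr j)))
        (Pi.single k 1 : V → ℝ) = 2 * ∑ j, W k j * Real.sin (θ j - θ k) := by
      simp only [sum_apply, smul_apply,
        sub_apply, hpr, ContinuousLinearMap.proj_apply, smul_eq_mul,
        mul_sub, Finset.sum_sub_distrib]
      rw [Finset.sum_comm (f := fun i j => W i j * (-Real.sin (θ i - θ j) *
        (Pi.single k 1 : V → ℝ) i))]
      simp only [Pi.single_apply, mul_ite, mul_one, mul_zero, Finset.sum_ite_eq',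
        Finset.mem_univ, if_true]
      rw [two_mul, sub_eq_add_neg, ← Finset.sum_neg_distrib]
      congr 1 <;> refine Finset.sum_congr rfl fun j _ => ?_
      · rw [← Real.sin_neg, neg_sub]
      · rw [hW j k]; ring
    have e2 : F' true (Pi.single k 1 : V → ℝ) = if k ∈ N then Real.cos (θ k) else 0 := by
      simp [hF', hpr, Pi.single_apply]
    have e3 : F' false (Pi.single k 1 : V → ℝ) = if k ∈ N then -Real.sin (θ k) else 0 := by
      simp [hF', hpr, Pi.single_apply]
    simp only [Fintype.sum_bool, add_apply, smul_apply,
      e1, e2, e3, smul_eq_mul, zero_apply] at h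
    split_ifs at h ⊢ <;> linear_combination h
  -- A zero multiplier on the energy would put all `e^{iθ_j}`, `j ∈ N`, on one line through the
  -- origin. Their signed lengths `q j` along it, each `±ρ` with `ρ ≠ 0`, cannot sum to zero when
  -- `N` is odd.
  have hΛ₀ : Λ₀ ≠ 0 := by
    rintro rfl
    have hz : ∀ k ∈ N, Λ true * Real.cos (θ k) - Λ false * Real.sin (θ k) = 0 := by
      intro k hkN
      simpa [hkN] using hk k
    have hpos : 0 < Λ true ^ 2 + Λ false ^ 2 := by
      by_contra hle
      apply hΛ
      have h1 : Λ true = 0 := by nlinarith [sq_nonneg (Λ true), sq_nonneg (Λ false)]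
      have h2 : Λ false = 0 := by nlinarith [sq_nonneg (Λ true), sq_nonneg (Λ false)]
      ext c
      · cases c <;> simp [h1, h2]
      · simp
    refine sum_ne_zero_of_odd_card hodd (Real.sqrt_pos.mpr hpos).ne'
      (q := fun j => Λ false * Real.cos (θ j) + Λ true * Real.sin (θ j)) (fun j hj => ?_) ?_
    · rw [← sq_eq_sq_iff_eq_or_eq_neg, Real.sq_sqrt hpos.le]
      linear_combination (Λ true ^ 2 + Λ false ^ 2) * Real.sin_sq_add_cos_sq (θ j) -
        (Λ true * Real.cos (θ j) - Λ false * Real.sin (θ j)) * hz j hj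
    · rw [Finset.sum_add_distrib, ← Finset.mul_sum, ← Finset.mul_sum, hs, hc]
      simp
  refine ⟨Λ true / (2 * Λ₀), Λ false / (2 * Λ₀), hs, hc, fun k => ?_⟩
  have h := hk k
  have h2 : (2 * Λ₀) ≠ 0 := mul_ne_zero two_ne_zero hΛ₀
  apply mul_left_cancel₀ h2
  rw [mul_zero, mul_add]
  refine Eq.trans ?_ h
  congr 1
  split_ifs
  · field_simp
  · simp

/-- Half of `N` at angle `π` and everything else at `0`: all sines vanish, so zero multipliers
suffice and no maximization is needed. -/
lemma exists_multipliers_of_even (W : V → V → ℝ) (N : Finset V) (heven : Even N.card) :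
    ∃ (θ : V → ℝ) (a b : ℝ), ∑ j ∈ N, Real.sin (θ j) = 0 ∧ ∑ j ∈ N, Real.cos (θ j) = 0 ∧
      ∀ k, ∑ j, W k j * Real.sin (θ j - θ k) +
        (if k ∈ N then a * Real.cos (θ k) - b * Real.sin (θ k) else 0) = 0 := by
  obtain ⟨m, hm⟩ := heven
  obtain ⟨M, hMN, hM⟩ := Finset.exists_subset_card_eq (s := N) (n := m) (by omega)
  have hs : ∀ v, Real.sin (if v ∈ M then Real.pi else 0) = 0 := fun v => by split_ifs <;> simp
  refine ⟨fun v => if v ∈ M then Real.pi else 0, 0, 0, ?_, ?_, fun k => ?_⟩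
  · simp [hs]
  · have hcos : ∀ v, Real.cos (if v ∈ M then Real.pi else 0) = 1 - 2 * if v ∈ M then 1 else 0 :=
      fun v => by split_ifs <;> norm_num
    simp only [hcos, Finset.sum_sub_distrib, ← Finset.mul_sum, Finset.sum_ite_mem,
      Finset.inter_eq_right.mpr hMN, Finset.sum_const, hM, hm]
    simp
    ring
  · simp [Real.sin_sub, hs]

lemma exists_units_multipliers (W : V → V → ℝ) (hW : ∀ i j, W i j = W j i) (N : Finset V)
    (hN : 2 ≤ N.card) :
    ∃ (u : V → ℂ) (A B : ℂ), (∀ i, u i ≠ 0) ∧ ∑ j ∈ N, u j = 0 ∧ ∑ j ∈ N, (u j)⁻¹ = 0 ∧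
      ∀ k, ∑ j, (W k j : ℂ) * (u j * (u k)⁻¹ - u k * (u j)⁻¹) +
        (if k ∈ N then A * (u k)⁻¹ - u k * B else 0) = 0 := by
  obtain ⟨θ, a, b, hs, hc, hk⟩ : ∃ (θ : V → ℝ) (a b : ℝ),
      ∑ j ∈ N, Real.sin (θ j) = 0 ∧ ∑ j ∈ N, Real.cos (θ j) = 0 ∧
      ∀ k, ∑ j, W k j * Real.sin (θ j - θ k) +
        (if k ∈ N then a * Real.cos (θ k) - b * Real.sin (θ k) else 0) = 0 := by
    rcases Nat.even_or_odd N.card with h | h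
    · exact exists_multipliers_of_even W N h
    · exact exists_multipliers_of_odd W hW N hN h
  have hu : ∀ j, Complex.exp (θ j * Complex.I) =
      (Real.cos (θ j) : ℂ) + (Real.sin (θ j) : ℂ) * Complex.I := fun j => by
    rw [Complex.exp_mul_I]; push_cast; rfl
  have hu' : ∀ j, (Complex.exp (θ j * Complex.I))⁻¹ =
      (Real.cos (θ j) : ℂ) - (Real.sin (θ j) : ℂ) * Complex.I := fun j => by
    rw [← Complex.exp_neg, ← neg_mul, ← Complex.ofReal_neg, Complex.exp_mul_I,
      ← Complex.ofReal_cos, ← Complex.ofReal_sin, Real.cos_neg, Real.sin_neg]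
    push_cast; ring
  have hsC : ∑ j ∈ N, (Real.sin (θ j) : ℂ) = 0 := by exact_mod_cast hs
  have hcC : ∑ j ∈ N, (Real.cos (θ j) : ℂ) = 0 := by exact_mod_cast hc
  -- With `B` conjugate to `A`, the term `A u⁻¹ - u B` is `2I (a cos θ - b sin θ)`, so each equation
  -- is `2I` times the real one.
  refine ⟨fun j => Complex.exp (θ j * Complex.I), b + a * Complex.I, b - a * Complex.I,
    fun i => Complex.exp_ne_zero _, ?_, ?_, fun k => ?_⟩
  · simp only [hu, Finset.sum_add_distrib, ← Finset.sum_mul, hsC, hcC, zero_mul, add_zero]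
  · simp only [hu', Finset.sum_sub_distrib, ← Finset.sum_mul, hsC, hcC, zero_mul, sub_zero]
  · have h := congrArg (fun t : ℝ => 2 * Complex.I * (t : ℂ)) (hk k)
    simp only [Complex.ofReal_zero, mul_zero] at h
    refine Eq.trans ?_ h
    rw [Complex.ofReal_add, mul_add, Complex.ofReal_sum, Finset.mul_sum]
    congr 1
    · refine Finset.sum_congr rfl fun j _ => ?_
      simp only [hu']
      simp only [hu, Real.sin_sub]
      push_cast
      ring
    · split_ifs
      · simp only [hu']
        simp only [hu]
        push_cast
        ring
      · simp

/-! ### A continuous family of points -/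

/-- The point of `ℂ ^ (2n)` with `y_i + I * x_i = u_i` and `y_i - I * x_i = u_i⁻¹`. -/
noncomputable def unitsPoint {ι : Type*} (u : ι → ℂ) : ι ⊕ ι → ℂ :=
  Sum.elim (fun i => (u i - (u i)⁻¹) / (2 * Complex.I)) (fun i => (u i + (u i)⁻¹) / 2)

lemma unitsPoint_inr_add {ι : Type*} (u : ι → ℂ) (i : ι) :
    unitsPoint u (.inr i) + Complex.I * unitsPoint u (.inl i) = u i := by
  have key : ∀ z : ℂ, Complex.I * (z / (2 * Complex.I)) = z / 2 := fun z => by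
    have := Complex.I_ne_zero
    field_simp
  simp only [unitsPoint, Sum.elim_inl, Sum.elim_inr, key]
  ring

lemma unitsPoint_div_mem_variety {ι : Type*} [Fintype ι] {G : SimpleGraph ι}
    [DecidableRel G.Adj] (v₀ : ι) {u : ι → ℂ} (h0 : ∀ i, u i ≠ 0)
    (h : ∀ i, ∑ j ∈ G.neighborFinset i, (u j * (u i)⁻¹ - u i * (u j)⁻¹) = 0) :
    unitsPoint (fun i => u i / u v₀) ∈ variety (idealK₀ G v₀) := by
  have hI := Complex.I_ne_zero
  have hI2 := Complex.I_sq
  refine mem_variety_idealK₀.mpr ⟨mem_variety_idealK.mpr ⟨fun i => ?_, fun i => ?_⟩, ?_, ?_⟩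
  · simp only [unitsPoint, Sum.elim_inl, Sum.elim_inr, div_pow, mul_pow, hI2]
    have := mul_inv_cancel₀ (div_ne_zero (h0 i) (h0 v₀))
    linear_combination this
  · rw [← mul_zero (1 / (2 * Complex.I)), ← h i, Finset.mul_sum]
    refine Finset.sum_congr rfl fun j _ => ?_
    have := h0 i
    have := h0 j
    have := h0 v₀
    simp only [unitsPoint, Sum.elim_inl, Sum.elim_inr]
    field_simp
    ring
  · simp [unitsPoint, h0]
  · simp [unitsPoint, h0]

/-- The base vertex may only be `a`, the vertex whose unit is known to move; `b` and `c` might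
return to their initial values. -/
lemma exists_triple_of_isKLet {ι : Type*} [DecidableEq ι] {G : SimpleGraph ι} {k : ℕ}
    (hk : 3 ≤ k) {S : Finset ι} (hS : IsKLet G k S) (v₀ : ι) :
    ∃ a b c : ι, a ≠ b ∧ a ≠ c ∧ b ≠ c ∧ v₀ ≠ b ∧ v₀ ≠ c ∧
      G.neighborSet b = G.neighborSet a ∧ G.neighborSet c = G.neighborSet a := by
  obtain ⟨hcard, hN⟩ := hS
  by_cases hv : v₀ ∈ S
  · have : 1 < (S.erase v₀).card := by rw [Finset.card_erase_of_mem hv]; omega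
    obtain ⟨b, hb, c, hc, hbc⟩ := Finset.one_lt_card.mp this
    rw [Finset.mem_erase] at hb hc
    exact ⟨v₀, b, c, hb.1.symm, hc.1.symm, hbc, hb.1.symm, hc.1.symm,
      hN _ hb.2 _ hv, hN _ hc.2 _ hv⟩
  · obtain ⟨a, b, c, ha, hb, hc, hab, hac, hbc⟩ := Finset.two_lt_card_iff.mp
      (show 2 < S.card by omega)
    exact ⟨a, b, c, hab, hac, hbc, fun h => hv (h ▸ hb), fun h => hv (h ▸ hc),
      hN _ hb _ ha, hN _ hc _ ha⟩

lemma exists_units_curve {G : SimpleGraph V} [DecidableRel G.Adj] {a b c : V}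
    (hdeg : 2 ≤ G.degree a) (hab : a ≠ b) (hac : a ≠ c) (hbc : b ≠ c)
    (hNb : G.neighborSet b = G.neighborSet a) (hNc : G.neighborSet c = G.neighborSet a) :
    ∃ U : ℝ → V → ℂ, (∀ i, ContinuousOn (fun t => U t i) unitInterval) ∧ U 0 a ≠ U 1 a ∧
      (∀ i, i ≠ a → i ≠ b → i ≠ c → U 0 i = U 1 i) ∧
      ∀ t ∈ unitInterval, (∀ i, U t i ≠ 0) ∧
        ∀ i, ∑ j ∈ G.neighborFinset i, (U t j * (U t i)⁻¹ - U t i * (U t j)⁻¹) = 0 := by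
  set T : Finset V := {a, b, c} with hT
  have hadj : ∀ s ∈ T, ∀ i, G.Adj i s ↔ i ∈ G.neighborFinset a := by
    intro s hs i
    have hs' : G.neighborSet s = G.neighborSet a := by
      simp only [hT, Finset.mem_insert, Finset.mem_singleton] at hs
      rcases hs with rfl | rfl | rfl
      · rfl
      · exact hNb
      · exact hNc
    rw [G.adj_comm, ← SimpleGraph.mem_neighborSet, hs', SimpleGraph.mem_neighborFinset,
      SimpleGraph.mem_neighborSet]
  have hTN : ∀ s ∈ T, s ∉ G.neighborFinset a := fun s hs h =>
    G.loopless.irrefl s ((hadj s hs s).mpr h)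
  -- The graph with the triple removed; the multiplier term stands in for the triple's action on
  -- `N`.
  set W : V → V → ℝ := fun i j => if G.Adj i j ∧ i ∉ T ∧ j ∉ T then 1 else 0 with hW
  have hWs : ∀ i j, W i j = W j i := fun i j => by
    simp only [hW, G.adj_comm i j, and_comm (a := i ∉ T)]
  obtain ⟨u, A, B, hu0, hsum, hsumi, hk⟩ :=
    exists_units_multipliers W hWs (G.neighborFinset a) hdeg
  obtain ⟨p, q, r, hp, hq, hr, hne, hpqr⟩ := exists_curve_sum_eq_sum_inv_eq A B
  set U : ℝ → V → ℂ := fun t i =>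
    if i = a then p t else if i = b then q t else if i = c then r t else u i with hU
  have hUa : ∀ t, U t a = p t := fun t => by simp [hU]
  have hUb : ∀ t, U t b = q t := fun t => by simp [hU, hab.symm]
  have hUc : ∀ t, U t c = r t := fun t => by simp [hU, hac.symm, hbc.symm]
  have hUu : ∀ t i, i ∉ T → U t i = u i := fun t i hi => by
    simp only [hT, Finset.mem_insert, Finset.mem_singleton, not_or] at hi
    simp [hU, hi]
  refine ⟨U, fun i => ?_, by simpa [hUa] using hne, fun i h1 h2 h3 => by simp [hU, h1, h2, h3],
    fun t ht => ?_⟩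
  · simp only [hU]
    split_ifs
    · exact hp
    · exact hq
    · exact hr
    · exact continuousOn_const
  obtain ⟨hp0, hq0, hr0, hA, hB⟩ := hpqr t ht
  refine ⟨fun i => ?_, fun i => ?_⟩
  · simp only [hU]
    split_ifs
    · exact hp0
    · exact hq0
    · exact hr0
    · exact hu0 i
  by_cases hi : i ∈ T
  · have hNi : G.neighborFinset i = G.neighborFinset a := by
      ext j
      rw [SimpleGraph.mem_neighborFinset, G.adj_comm, hadj i hi]
    have hUN : ∀ j ∈ G.neighborFinset a, U t j = u j := fun j hj =>
      hUu t j fun hjT => hTN j hjT hj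
    rw [hNi, Finset.sum_sub_distrib, ← Finset.sum_mul, ← Finset.mul_sum,
      Finset.sum_congr rfl hUN, Finset.sum_congr rfl fun j hj => congrArg (·⁻¹) (hUN j hj),
      hsum, hsumi]
    simp
  · rw [← hk i, SimpleGraph.neighborFinset_eq_filter, Finset.sum_filter,
      ← Finset.sum_sdiff (Finset.subset_univ T)]
    congr 1
    · rw [← Finset.sum_sdiff (Finset.subset_univ T) (f := fun j => (W i j : ℂ) * _)]
      rw [Finset.sum_eq_zero (s := T), add_zero]
      · refine Finset.sum_congr rfl fun j hj => ?_
        have hj' : j ∉ T := (Finset.mem_sdiff.mp hj).2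
        simp only [hW, hi, hj', hUu, not_false_eq_true, and_true]
        split_ifs <;> simp
      · intro j hj
        simp [hW, hj]
    · have hif : ∀ j ∈ T, (if G.Adj i j then U t j * (U t i)⁻¹ - U t i * (U t j)⁻¹ else 0) =
          if i ∈ G.neighborFinset a then U t j * (u i)⁻¹ - u i * (U t j)⁻¹ else 0 := by
        intro j hj
        simp only [hadj j hj i, hUu t i hi]
      rw [Finset.sum_congr rfl hif, hT, Finset.sum_insert (by simp [hab, hac]),
        Finset.sum_insert (by simp [hbc]), Finset.sum_singleton, hUa, hUb, hUc]
      split_ifs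
      · rw [← hA, ← hB]; ring
      · simp

lemma exists_joinedIn_variety {G : SimpleGraph V} [DecidableRel G.Adj] (hG : IsSCT G)
    {k : ℕ} (hk : 3 ≤ k) {S : Finset V} (hS : IsKLet G k S) (v₀ : V) :
    ∃ p q : V ⊕ V → ℂ, p ≠ q ∧ JoinedIn (variety (idealK₀ G v₀)) p q := by
  obtain ⟨a, b, c, hab, hac, hbc, hvb, hvc, hNb, hNc⟩ := exists_triple_of_isKLet hk hS v₀
  obtain ⟨U, hUc, hUa, hUu, hU⟩ :=
    exists_units_curve (hG.two_le_degree a) hab hac hbc hNb hNc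
  have h0 := (hU 0 ⟨le_rfl, zero_le_one⟩).1
  have h1 := (hU 1 ⟨zero_le_one, le_rfl⟩).1
  refine ⟨unitsPoint fun i => U 0 i / U 0 v₀, unitsPoint fun i => U 1 i / U 1 v₀, fun heq => ?_,
    JoinedIn.ofLine (f := fun t => unitsPoint fun i => U t i / U t v₀) ?_ rfl rfl ?_⟩
  · have hdiv : ∀ i, U 0 i / U 0 v₀ = U 1 i / U 1 v₀ := fun i => by
      rw [← unitsPoint_inr_add (fun i => U 0 i / U 0 v₀), heq, unitsPoint_inr_add]
    -- If `v₀` is the moving vertex, a fixed neighbour moves relative to it; otherwise `v₀` is fixed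
    -- and `a` moves relative to it.
    by_cases hva : v₀ = a
    · subst hva
      obtain ⟨j, hj⟩ : (G.neighborFinset v₀).Nonempty := by
        rw [← Finset.card_pos, SimpleGraph.card_neighborFinset_eq_degree]
        have := hG.two_le_degree v₀
        omega
      rw [SimpleGraph.mem_neighborFinset] at hj
      have hjb : j ≠ b := by
        rintro rfl
        have : j ∈ G.neighborSet j := hNb ▸ hj
        exact G.loopless.irrefl j this
      have hjc : j ≠ c := by
        rintro rfl
        have : j ∈ G.neighborSet j := hNc ▸ hj
        exact G.loopless.irrefl j this
      have h := hdiv j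
      rw [hUu j hj.ne' hjb hjc, div_eq_div_iff (h0 v₀) (h1 v₀)] at h
      exact hUa (mul_left_cancel₀ (h1 j) h).symm
    · have h := hdiv a
      rw [hUu v₀ hva hvb hvc] at h
      exact hUa ((div_left_inj' (h1 v₀)).mp h)
  · have hc : ∀ i, ContinuousOn (fun t => U t i / U t v₀) unitInterval := fun i =>
      (hUc i).div (hUc v₀) fun t ht => (hU t ht).1 v₀
    have hci : ∀ i, ContinuousOn (fun t => (U t i / U t v₀)⁻¹) unitInterval := fun i =>
      (hc i).inv₀ fun t ht => div_ne_zero ((hU t ht).1 i) ((hU t ht).1 v₀)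
    refine continuousOn_pi.mpr fun s => ?_
    rcases s with i | i
    · exact ((hc i).sub (hci i)).div_const _
    · exact ((hc i).add (hci i)).div_const _
  · rintro _ ⟨t, ht, rfl⟩
    exact unitsPoint_div_mem_variety v₀ (hU t ht).1 (hU t ht).2

end Kuramoto

theorem corollary2p9 {V : Type*} [Fintype V] [DecidableEq V]
    (G : SimpleGraph V) [DecidableRel G.Adj] (hG : Kuramoto.IsSCT G)
    (k : ℕ) (hk : 3 ≤ k) (hS : ∃ S : Finset V, Kuramoto.IsKLet G k S) :
    -- the Kuramoto variety has positive dimension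
    0 < Kuramoto.affineDim (Kuramoto.variety (Kuramoto.idealK G)) ∧
    ∀ v₀ : V,
      -- it has positive dimension even after the rotational symmetry has been removed
      0 < Kuramoto.affineDim (Kuramoto.variety (Kuramoto.idealK₀ G v₀)) ∧
      -- it contains a continuous family of points, no two of which differ by a rotation
      (∃ p q : V ⊕ V → ℂ, p ≠ q ∧ JoinedIn (Kuramoto.variety (Kuramoto.idealK₀ G v₀)) p q) ∧
      -- a point on an irreducible component of positive dimension is not linearly stable
      (∀ P ∈ (Kuramoto.idealK₀ G v₀).minimalPrimes,
        0 < Kuramoto.affineDim (Kuramoto.variety P) →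
        ∀ θ : V → ℝ, Kuramoto.point v₀ θ ∈ Kuramoto.variety P →
          ¬ Kuramoto.LinearlyStable G θ) ∧
      -- a point on a continuous family is not linearly stable
      (∀ θ : V → ℝ, ∀ q : V ⊕ V → ℂ, q ≠ Kuramoto.point v₀ θ →
        JoinedIn (Kuramoto.variety (Kuramoto.idealK₀ G v₀)) (Kuramoto.point v₀ θ) q →
          ¬ Kuramoto.LinearlyStable G θ) := by
  obtain ⟨S, hS⟩ := hS
  have hinf : ∀ v₀ : V, (Kuramoto.variety (Kuramoto.idealK₀ G v₀)).Infinite := fun v₀ => by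
    obtain ⟨p, q, hpq, hj⟩ := Kuramoto.exists_joinedIn_variety hG hk hS v₀
    exact Kuramoto.infinite_of_joinedIn hpq hj
  obtain ⟨v⟩ := hG.connected.nonempty
  refine ⟨Kuramoto.affineDim_pos_of_infinite
    ((hinf v).mono (Kuramoto.variety_idealK₀_subset G v)), fun v₀ =>
    ⟨Kuramoto.affineDim_pos_of_infinite (hinf v₀),
      Kuramoto.exists_joinedIn_variety hG hk hS v₀, ?_, ?_⟩⟩
  · intro P hP hdim θ hθ hst
    have := hP.1.1
    exact hdim.ne' (hst.affineDim_eq_zero v₀ hP.1.2 hθ)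
  · intro θ q hq hj hst
    exact hq (hst.eq_of_joinedIn v₀ hj)
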